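/- Let $p$ be a prime, let $q=p^e$ with $e\ge 1$, and let $m,k\ge 1$. Let $f\in\mathbb{F}_{q^m}[x_1,\ldots,x_k]$ be a polynomial of total degree $d\ge 1$, and let $N(f=y^q-y)$ denote the number of $(x_1,\ldots,x_k,y)\in\mathbb{F}_{q^m}^{k+1}$ with $f(x_1,\ldots,x_k)=y^q-y$. For $a\in\mathbb{N}$ let $S_p(a)$ be the sum of the base-$p$ digits of $a$, and put \[ W_p(d,\mathbb{F}_{q^m}^k)=\max\Bigl\{\sum_{i=1}^k S_p(t_i) : (t_1,\ldots,t_k)\in\{0,1,\ldots,q^m-1\}^k,\ t_1+\cdots+t_k\le d\Bigr\}. \] Then \[ \nu_p\bigl(N(f=y^q-y)\bigr)\ \ge\ \left\lceil \frac{emk}{W_p(d,\mathbb{F}_{q^m}^k)}\right\rceil , \] where $\nu_p$ is the $p$-adic valuation, with $\nu_p(0)=\infty$. -/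

import Mathlib

namespace ArtinSchreierCount

/-- The sum `S_p(a)` of the base-`p` digits of `a`. -/
def digitSum (p a : ℕ) : ℕ := (Nat.digits p a).sum

/-- `maxDigitSum p Q k d` is the maximum of `S_p(t₁) + ⋯ + S_p(t_k)` over all tuples
`t ∈ [0, Q - 1]^k` with `t₁ + ⋯ + t_k ≤ d`. The set of tuples is finite and, for `Q ≥ 1`,
contains `t = 0`, so the supremum is a maximum. -/
def maxDigitSum (p Q k d : ℕ) : ℕ :=
  ((Fintype.piFinset fun _ : Fin k => Finset.range Q).filter fun t => ∑ i, t i ≤ d).sup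
    fun t => ∑ i, digitSum p (t i)

/-- The number of solutions `(x₁, …, x_k, y)` in `K^(k+1)` of `f(x₁, …, x_k) = y ^ q - y`. -/
noncomputable def solutionCount {K : Type*} [Field K] {k : ℕ}
    (f : MvPolynomial (Fin k) K) (q : ℕ) : ℕ :=
  Nat.card {z : (Fin k → K) × K // MvPolynomial.eval z.1 f = z.2 ^ q - z.2}

end ArtinSchreierCount

/-! Orthogonality of characters gives N = ∑_β ∑_x ψ(β(f(x))), over the F_p-linear functionals β
killing all y^q - y; no power of p is lost, so each inner sum can be bounded separately. Here ψ
takes p-th roots of unity as values in ℤ[ζ_p], where π = ζ_p - 1 has π^(p-1) associated to p.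

Frobenius is additive, so x^t has functional degree at most S_p(t), and β ∘ f has degree at most W
(`functionalDegreeLE_eval`). Hence j-fold differences of ψ ∘ β ∘ f are divisible by π^⌈j/W⌉
(`diffDvd_addChar`), and summing over a line of p points is worth p - 1 differences
(`DiffDvd.sum_line`). Over emk coordinates, π^⌈emk(p-1)/W⌉ divides N; as N is an integer, p^⌈emk/W⌉
does too. -/

namespace ArtinSchreierCount

/-! ### Functional degree of maps between abelian groups -/

section FunctionalDegree

variable {G H B C : Type*} [AddCommGroup G] [AddCommGroup H] [AddCommGroup B] [AddCommGroup C]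

/-- A map between abelian groups has functional degree at most `r` if all of its `(r + 1)`-fold
forward differences vanish. -/
def FunctionalDegreeLE : ℕ → (G → B) → Prop
  | 0, h => ∀ v, fwdDiff v h = 0
  | r + 1, h => ∀ v, FunctionalDegreeLE r (fwdDiff v h)

theorem functionalDegreeLE_const (r : ℕ) (c : B) :
    FunctionalDegreeLE r (fun _ : G => c) := by
  induction r generalizing c with
  | zero => intro v; ext; simp [fwdDiff]
  | succ r ih => intro v; simpa using ih 0

theorem FunctionalDegreeLE.succ {r : ℕ} {h : G → B} (hh : FunctionalDegreeLE r h) :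
    FunctionalDegreeLE (r + 1) h := by
  induction r generalizing h with
  | zero => intro v; rw [hh v]; exact functionalDegreeLE_const 0 0
  | succ r ih => intro v; exact ih (hh v)

theorem FunctionalDegreeLE.mono {r s : ℕ} (hrs : r ≤ s) {h : G → B}
    (hh : FunctionalDegreeLE r h) : FunctionalDegreeLE s h := by
  induction hrs with
  | refl => exact hh
  | step _ ih => exact ih.succ

theorem FunctionalDegreeLE.add {r : ℕ} {g h : G → B} (hg : FunctionalDegreeLE r g)
    (hh : FunctionalDegreeLE r h) : FunctionalDegreeLE r (g + h) := by
  induction r generalizing g h with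
  | zero => intro v; rw [fwdDiff_add, hg v, hh v, add_zero]
  | succ r ih => intro v; rw [fwdDiff_add]; exact ih (hg v) (hh v)

theorem FunctionalDegreeLE.sum {ι : Type*} (s : Finset ι) {r : ℕ} {h : ι → G → B}
    (hh : ∀ i ∈ s, FunctionalDegreeLE r (h i)) : FunctionalDegreeLE r (∑ i ∈ s, h i) :=
  Finset.sum_induction _ _ (fun _ _ => FunctionalDegreeLE.add)
    (functionalDegreeLE_const r (0 : B)) hh

theorem FunctionalDegreeLE.map {r : ℕ} {h : G → B} (hh : FunctionalDegreeLE r h) (φ : B →+ C) :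
    FunctionalDegreeLE r (φ ∘ h) := by
  have key (v : G) (h : G → B) : fwdDiff v (φ ∘ h) = φ ∘ fwdDiff v h := by
    ext; simp [fwdDiff]
  induction r generalizing h with
  | zero => intro v; rw [key, hh v]; ext; simp
  | succ r ih => intro v; rw [key]; exact ih (hh v)

theorem FunctionalDegreeLE.comap {r : ℕ} {h : H → B} (hh : FunctionalDegreeLE r h) (φ : G →+ H) :
    FunctionalDegreeLE r (h ∘ φ) := by
  have key (v : G) (h : H → B) : fwdDiff v (h ∘ φ) = fwdDiff (φ v) h ∘ φ := by
    ext; simp [fwdDiff]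
  induction r generalizing h with
  | zero => intro v; rw [key, hh]; rfl
  | succ r ih => intro v; rw [key]; exact ih (hh _)

theorem functionalDegreeLE_addMonoidHom (φ : G →+ B) : FunctionalDegreeLE 1 φ := by
  intro v
  have : fwdDiff v φ = fun _ => φ v := by ext; simp [fwdDiff]
  rw [this]
  exact functionalDegreeLE_const 0 _

end FunctionalDegree

/-! ### Functional degree of products and powers -/

section Product

variable {G S : Type*} [AddCommGroup G] [CommRing S]

theorem fwdDiff_mul (v : G) (g h : G → S) :
    fwdDiff v (g * h) = fwdDiff v g * h + g * fwdDiff v h + fwdDiff v g * fwdDiff v h :=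
  fwdDiff_smul v g h

theorem FunctionalDegreeLE.const_mul {r : ℕ} {g h : G → S} (hg : FunctionalDegreeLE 0 g)
    (hh : FunctionalDegreeLE r h) : FunctionalDegreeLE r (g * h) := by
  have : g * h = AddMonoidHom.mulLeft (g 0) ∘ h := by
    ext x
    have := congrFun (hg x) 0
    simp only [fwdDiff, zero_add, Pi.zero_apply, sub_eq_zero] at this
    simp [this]
  rw [this]
  exact hh.map _

theorem FunctionalDegreeLE.mul {r s : ℕ} {g h : G → S} (hg : FunctionalDegreeLE r g)
    (hh : FunctionalDegreeLE s h) : FunctionalDegreeLE (r + s) (g * h) := by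
  induction hn : r + s generalizing r s g h with
  | zero =>
    obtain ⟨rfl, rfl⟩ : r = 0 ∧ s = 0 := by omega
    exact hg.const_mul hh
  | succ n ih =>
    -- The zero map counts as degree 0, so differencing a constant lowers nothing; constant factors
    -- are split off.
    rcases r with _ | r
    · rw [show s = n + 1 by omega] at hh
      exact hg.const_mul hh
    rcases s with _ | s
    · rw [show r = n by omega] at hg
      rw [mul_comm]
      exact hh.const_mul hg
    intro v
    rw [fwdDiff_mul]
    exact ((ih (hg v) hh (by omega)).add (ih hg (hh v) (by omega))).add
      (ih (hg v) (hh v).succ (by omega))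

theorem FunctionalDegreeLE.pow {r : ℕ} {g : G → S} (hg : FunctionalDegreeLE r g) (n : ℕ) :
    FunctionalDegreeLE (n * r) (g ^ n) := by
  induction n with
  | zero => rw [pow_zero]; exact functionalDegreeLE_const _ (1 : S)
  | succ n ih => rw [pow_succ, add_mul, one_mul]; exact ih.mul hg

theorem FunctionalDegreeLE.prod {ι : Type*} (s : Finset ι) {r : ι → ℕ} {g : ι → G → S}
    (hg : ∀ i ∈ s, FunctionalDegreeLE (r i) (g i)) :
    FunctionalDegreeLE (∑ i ∈ s, r i) (∏ i ∈ s, g i) := by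
  classical
  induction s using Finset.induction_on with
  | empty => rw [Finset.prod_empty]; exact functionalDegreeLE_const _ (1 : S)
  | insert a s ha ih =>
    rw [Finset.sum_insert ha, Finset.prod_insert ha]
    exact (hg a (by simp)).mul (ih fun i hi => hg i (by simp [hi]))

/-- Write t = t % p + p * (t / p): raising to the p-th power is additive and costs no degree, so
each digit costs only its value. -/
theorem FunctionalDegreeLE.pow_digitSum (p : ℕ) [Fact p.Prime] [CharP S p] {g : G → S}
    (hg : FunctionalDegreeLE 1 g) (t : ℕ) : FunctionalDegreeLE (digitSum p t) (g ^ t) := by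
  have hp : 1 < p := (Fact.out : p.Prime).one_lt
  induction t using Nat.strong_induction_on with
  | _ t ih =>
    rcases Nat.eq_zero_or_pos t with rfl | ht
    · rw [pow_zero]; exact functionalDegreeLE_const _ (1 : S)
    have hpow : g ^ t = g ^ (t % p) * (frobenius S p).toAddMonoidHom ∘ (g ^ (t / p)) := by
      ext x
      simp only [Pi.pow_apply, Pi.mul_apply, Function.comp_apply, RingHom.toAddMonoidHom_eq_coe,
        AddMonoidHom.coe_coe, frobenius_def, ← pow_mul, ← pow_add]
      rw [mul_comm, Nat.mod_add_div]
    have hdig : digitSum p t = t % p * 1 + digitSum p (t / p) := by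
      rw [digitSum, digitSum, Nat.digits_def' hp ht, List.sum_cons, mul_one]
    rw [hpow, hdig]
    exact (hg.pow _).mul ((ih _ (Nat.div_lt_self ht hp)).map _)

end Product

/-! ### Functional degree of polynomial maps -/

/-- Exponents of a finite field can be reduced below its cardinality without changing
the power function. -/
theorem exists_lt_card_pow_eq {K : Type*} [Field K] [Finite K] (t : ℕ) :
    ∃ s ≤ t, s < Nat.card K ∧ ∀ x : K, x ^ s = x ^ t := by
  have := Fintype.ofFinite K
  induction t using Nat.strong_induction_on with
  | _ t ih =>
    by_cases ht : t < Nat.card K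
    · exact ⟨t, le_rfl, ht, fun _ => rfl⟩
    have h1 : 1 < Nat.card K := Finite.one_lt_card
    -- The new exponent is still positive, so x = 0 needs no separate case.
    obtain ⟨s, hs, hsK, hx⟩ := ih (t - Nat.card K + 1) (by omega)
    refine ⟨s, by omega, hsK, fun x => ?_⟩
    rw [hx, pow_succ]
    nth_rw 2 [← FiniteField.pow_card x]
    rw [← Nat.card_eq_fintype_card, ← pow_add]
    congr 1
    omega

theorem functionalDegreeLE_eval {K : Type*} [Field K] [Finite K] (p : ℕ) [Fact p.Prime]
    [CharP K p] {k : ℕ} (f : MvPolynomial (Fin k) K) :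
    FunctionalDegreeLE (maxDigitSum p (Nat.card K) k f.totalDegree)
      (fun x : Fin k → K => MvPolynomial.eval x f) := by
  have heq : (fun x : Fin k → K => MvPolynomial.eval x f) =
      ∑ t ∈ f.support, AddMonoidHom.mulLeft (f.coeff t) ∘
        ∏ i, (Pi.evalAddMonoidHom (fun _ : Fin k => K) i : (Fin k → K) → K) ^ t i := by
    ext x
    simp [MvPolynomial.eval_eq', Finset.sum_apply, Finset.prod_apply]
  rw [heq]
  refine FunctionalDegreeLE.sum _ fun t ht => FunctionalDegreeLE.map ?_ _
  -- `maxDigitSum` only sees exponents below |K|; the reduction never raises an exponent, so the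
  -- degree bound survives.
  choose s hst hsK hs using fun i => exists_lt_card_pow_eq (K := K) (t i)
  have hprod : ∏ i, (Pi.evalAddMonoidHom (fun _ : Fin k => K) i : (Fin k → K) → K) ^ t i =
      ∏ i, (Pi.evalAddMonoidHom (fun _ : Fin k => K) i : (Fin k → K) → K) ^ s i := by
    refine Finset.prod_congr rfl fun i _ => ?_
    ext x
    simp [hs]
  rw [hprod]
  refine (FunctionalDegreeLE.prod _ fun i _ =>
    (functionalDegreeLE_addMonoidHom _).pow_digitSum p (s i)).mono ?_
  have hsum : ∑ i, s i ≤ f.totalDegree := by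
    refine (Finset.sum_le_sum fun i _ => hst i).trans ?_
    have := MvPolynomial.le_totalDegree ht
    rwa [Finsupp.sum_fintype _ _ (fun _ => rfl)] at this
  exact Finset.le_sup (f := fun t : Fin k → ℕ => ∑ i, digitSum p (t i))
    (by simpa [Fintype.mem_piFinset] using ⟨hsK, hsum⟩)

/-! ### Divisibility of differences and Ax's bound for character sums -/

section DiffDvd

variable {G H R : Type*} [AddCommGroup G] [AddCommGroup H] [CommRing R] {π : R} {W : ℕ}

/-- `DiffDvd π W M b F` says that for every `j ≤ M` all `j`-fold forward differences of `F` are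
divisible by `π ^ ⌈(j + b) / W⌉`. -/
def DiffDvd (π : R) (W : ℕ) : ℕ → ℕ → (G → R) → Prop
  -- For W > 0, `W * E < b + W` means E ≤ ⌈b / W⌉.
  | 0, b, F => ∀ E x, W * E < b + W → π ^ E ∣ F x
  | M + 1, b, F => (∀ E x, W * E < b + W → π ^ E ∣ F x) ∧
      ∀ v, DiffDvd π W M (b + 1) (fwdDiff v F)

theorem DiffDvd.pow_dvd {M b : ℕ} {F : G → R} (hF : DiffDvd π W M b F) {E : ℕ}
    (hE : W * E < b + W) (x : G) : π ^ E ∣ F x := by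
  cases M with
  | zero => exact hF E x hE
  | succ M => exact hF.1 E x hE

theorem DiffDvd.of_succ {M b : ℕ} {F : G → R} (hF : DiffDvd π W (M + 1) b F) :
    DiffDvd π W M b F := by
  induction M generalizing b F with
  | zero => exact hF.1
  | succ M ih => exact ⟨hF.1, fun v => ih (hF.2 v)⟩

theorem DiffDvd.mono {M b c : ℕ} {F : G → R} (hF : DiffDvd π W M b F) (hcb : c ≤ b) :
    DiffDvd π W M c F := by
  induction M generalizing b c F with
  | zero => exact fun E x hE => hF E x (by omega)
  | succ M ih => exact ⟨fun E x hE => hF.1 E x (by omega), fun v => ih (hF.2 v) (by omega)⟩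

theorem DiffDvd.add {M b : ℕ} {F F' : G → R} (hF : DiffDvd π W M b F)
    (hF' : DiffDvd π W M b F') : DiffDvd π W M b (F + F') := by
  induction M generalizing b F F' with
  | zero => exact fun E x hE => dvd_add (hF E x hE) (hF' E x hE)
  | succ M ih =>
    refine ⟨fun E x hE => dvd_add (hF.1 E x hE) (hF'.1 E x hE), fun v => ?_⟩
    rw [fwdDiff_add]
    exact ih (hF.2 v) (hF'.2 v)

theorem diffDvd_zero (M b : ℕ) : DiffDvd π W M b (0 : G → R) := by
  induction M generalizing b with
  | zero => exact fun _ _ _ => dvd_zero _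
  | succ M ih =>
    refine ⟨fun _ _ _ => dvd_zero _, fun v => ?_⟩
    rw [show fwdDiff v (0 : G → R) = 0 from fwdDiff_const v (0 : R)]
    exact ih _

theorem DiffDvd.sum {ι : Type*} (s : Finset ι) {M b : ℕ} {F : ι → G → R}
    (hF : ∀ i ∈ s, DiffDvd π W M b (F i)) : DiffDvd π W M b (∑ i ∈ s, F i) :=
  Finset.sum_induction _ _ (fun _ _ => DiffDvd.add) (diffDvd_zero M b) hF

theorem diffDvd_const {c : R} {b : ℕ} (hc : ∀ E, W * E < b + W → π ^ E ∣ c) (M : ℕ) :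
    DiffDvd π W M b (fun _ : G => c) := by
  cases M with
  | zero => exact fun E _ hE => hc E hE
  | succ M =>
    refine ⟨fun E _ hE => hc E hE, fun v => ?_⟩
    rw [fwdDiff_const]
    exact diffDvd_zero M _

theorem DiffDvd.mul (hW : 0 < W) {M b c : ℕ} {F F' : G → R} (hF : DiffDvd π W M b F)
    (hF' : DiffDvd π W M c F') : DiffDvd π W M (b + c) (F * F') := by
  have base {b c E : ℕ} {y z : R} (hy : ∀ E, W * E < b + W → π ^ E ∣ y)
      (hz : ∀ E, W * E < c + W → π ^ E ∣ z) (hE : W * E < b + c + W) : π ^ E ∣ y * z := by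
    -- `(b + W - 1) / W` is ⌈b / W⌉; the claim is subadditivity of the ceiling.
    have hb : W * ((b + W - 1) / W) < b + W :=
      (Nat.mul_div_le _ _).trans_lt (by omega)
    have hc : W * ((c + W - 1) / W) < c + W :=
      (Nat.mul_div_le _ _).trans_lt (by omega)
    refine (pow_dvd_pow π ?_).trans (pow_add π _ _ ▸ mul_dvd_mul (hy _ hb) (hz _ hc))
    have hb' := Nat.lt_mul_div_succ (b + W - 1) hW
    have hc' := Nat.lt_mul_div_succ (c + W - 1) hW
    by_contra hlt
    have : W * ((b + W - 1) / W + (c + W - 1) / W + 1) ≤ W * E :=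
      Nat.mul_le_mul_left W (by omega)
    simp only [mul_add, mul_one] at this hb' hc'
    omega
  induction M generalizing b c F F' with
  | zero => exact fun E x hE => base (fun E => hF E x) (fun E => hF' E x) hE
  | succ M ih =>
    refine ⟨fun E x hE => base (fun E => hF.1 E x) (fun E => hF'.1 E x) hE, fun v => ?_⟩
    rw [fwdDiff_mul]
    refine (DiffDvd.add ?_ ?_).add ?_
    · exact (ih (hF.2 v) hF'.of_succ).mono (by omega)
    · exact (ih hF.of_succ (hF'.2 v)).mono (by omega)
    · exact (ih (hF.2 v) (hF'.2 v)).mono (by omega)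

theorem DiffDvd.comap {M b : ℕ} {F : H → R} (hF : DiffDvd π W M b F) (φ : G →+ H) :
    DiffDvd π W M b (F ∘ φ) := by
  induction M generalizing b F with
  | zero => exact fun E x hE => hF E (φ x) hE
  | succ M ih =>
    refine ⟨fun E x hE => hF.1 E (φ x) hE, fun v => ?_⟩
    have : fwdDiff v (F ∘ φ) = fwdDiff (φ v) F ∘ φ := by ext; simp [fwdDiff]
    rw [this]
    exact ih (hF.2 _)

theorem DiffDvd.iterate {M b : ℕ} {F : G → R} (v : G) (j : ℕ) (hF : DiffDvd π W (M + j) b F) :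
    DiffDvd π W M (b + j) ((fwdDiff v)^[j] F) := by
  induction j generalizing b F with
  | zero => exact hF
  | succ j ih =>
    rw [Function.iterate_succ_apply, show b + (j + 1) = b + 1 + j by omega]
    exact ih (hF.2 v)

/-- If `h` has functional degree at most `r ≤ W` and `ψ` is an additive character that is trivial
modulo `π`, then `ψ ∘ h - 1` is highly divisible after taking differences. -/
theorem diffDvd_addChar_sub_one {A : Type*} [AddCommGroup A] (ψ : AddChar A R)
    (hψ : ∀ a, π ∣ ψ a - 1) (M : ℕ) {r : ℕ} (hr : r ≤ W) (hW : 0 < W) {h : G → A}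
    (hh : FunctionalDegreeLE r h) : DiffDvd π W M (W - r) (fun x => ψ (h x) - 1) := by
  have base {r : ℕ} (hr : r ≤ W) {h : G → A} (hh : FunctionalDegreeLE r h) (E : ℕ) (x : G)
      (hE : W * E < W - r + W) : π ^ E ∣ ψ (h x) - 1 := by
    have : E ≤ 1 := by
      by_contra hlt
      have := Nat.mul_le_mul_left W (show 2 ≤ E by omega)
      omega
    exact (pow_dvd_pow π this).trans (by simpa using hψ _)
  induction M generalizing r h with
  | zero => exact base hr hh
  | succ M ih =>
    refine ⟨base hr hh, fun v => ?_⟩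
    -- Each difference of `h` lowers its degree by one, which pays for the increase of b = W - r.
    have key : fwdDiff v (fun x => ψ (h x) - 1) =
        (fun x => ψ (h x) - 1) * (fun x => ψ (fwdDiff v h x) - 1) +
          fun x => ψ (fwdDiff v h x) - 1 := by
      ext x
      have hx : h (x + v) = h x + fwdDiff v h x := by simp [fwdDiff]
      simp only [Pi.add_apply, Pi.mul_apply]
      rw [fwdDiff, hx, AddChar.map_add_eq_mul]
      ring
    rw [key]
    rcases r with _ | r
    · have hv : (fun x => ψ (fwdDiff v h x) - 1) = 0 := by
        ext x; simp [hh v]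
      rw [hv, mul_zero, add_zero]
      exact diffDvd_zero _ _
    · have h1 := ih (by omega) (hh v)
      exact (((ih hr hh).mul hW h1).mono (by omega)).add (h1.mono (by omega))

theorem diffDvd_addChar {A : Type*} [AddCommGroup A] (ψ : AddChar A R)
    (hψ : ∀ a, π ∣ ψ a - 1) (M : ℕ) (hW : 0 < W) {h : G → A}
    (hh : FunctionalDegreeLE W h) : DiffDvd π W M 0 (fun x => ψ (h x)) := by
  have h1 := diffDvd_addChar_sub_one ψ hψ M le_rfl hW hh
  have h2 : DiffDvd π W M 0 (fun _ : G => (1 : R)) := by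
    refine diffDvd_const (fun E hE => ?_) M
    have : E = 0 := by
      by_contra hne
      have := Nat.mul_le_mul_left W (Nat.one_le_iff_ne_zero.2 hne)
      omega
    simp [this]
  rw [Nat.sub_self] at h1
  convert h1.add h2 using 1
  ext; simp

/-- Newton's expansion of F(x + j v), summed over j by the hockey-stick identity. -/
theorem sum_range_shift_eq (F : G → R) (v x : G) (n : ℕ) :
    ∑ j ∈ Finset.range n, F (x + j • v) =
      ∑ i ∈ Finset.range n, (n.choose (i + 1) : R) * (fwdDiff v)^[i] F x := by
  induction n with
  | zero => simp
  | succ n ih =>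
    rw [Finset.sum_range_succ, ih, shift_eq_sum_fwdDiff_iter v F n x]
    have : ∑ i ∈ Finset.range n, (n.choose (i + 1) : R) * (fwdDiff v)^[i] F x =
        ∑ i ∈ Finset.range (n + 1), (n.choose (i + 1) : R) * (fwdDiff v)^[i] F x := by
      simp [Finset.sum_range_succ _ n]
    rw [this, ← Finset.sum_add_distrib]
    refine Finset.sum_congr rfl fun i _ => ?_
    rw [Nat.choose_succ_succ, nsmul_eq_mul]
    push_cast
    ring

/-- Summing over a line of `p` points improves the divisibility by `p - 1` steps. -/
theorem DiffDvd.sum_line {p : ℕ} (hp : p.Prime) (hπ : π ^ (p - 1) ∣ (p : R)) (hW : 0 < W)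
    {b : ℕ} {F : G → R} (hF : ∀ M, DiffDvd π W M b F) (v : G) (M : ℕ) :
    DiffDvd π W M (b + (p - 1)) (fun x => ∑ j ∈ Finset.range p, F (x + j • v)) := by
  have heq : (fun x => ∑ j ∈ Finset.range p, F (x + j • v)) =
      ∑ i ∈ Finset.range p, (fun _ => (p.choose (i + 1) : R)) * (fwdDiff v)^[i] F := by
    ext x
    simp [sum_range_shift_eq, Finset.sum_apply]
  rw [heq]
  refine DiffDvd.sum _ fun i hi => ?_
  rw [Finset.mem_range] at hi
  -- Below the top index the binomial coefficient supplies p, hence π^(p-1); at the top it is 1, but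
  -- p - 1 differences have been taken.
  rcases Nat.lt_or_ge (i + 1) p with hlt | hge
  · have hdvd : π ^ (p - 1) ∣ (p.choose (i + 1) : R) :=
      hπ.trans (Nat.cast_dvd_cast (hp.dvd_choose_self (by omega) hlt))
    have hc : DiffDvd π W M (p - 1) (fun _ : G => (p.choose (i + 1) : R)) := by
      refine diffDvd_const (fun E hE => (pow_dvd_pow π ?_).trans hdvd) M
      by_contra hne
      have h1 : W * (p - 1 + 1) ≤ W * E := Nat.mul_le_mul_left W (by omega)
      have h2 : p - 1 ≤ W * (p - 1) := Nat.le_mul_of_pos_left _ hW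
      rw [mul_add] at h1
      omega
    exact (hc.mul hW (DiffDvd.iterate v i (hF (M + i)))).mono (by omega)
  · obtain rfl : i = p - 1 := by omega
    have h1 : (fun _ : G => (p.choose (p - 1 + 1) : R)) = 1 := by
      ext; simp [Nat.sub_add_cancel hp.one_le]
    rw [h1, one_mul]
    exact DiffDvd.iterate v _ (hF _)

theorem sum_zmod_eq_sum_range {A : Type*} [AddCommMonoid A] (p : ℕ) [NeZero p] (g : ZMod p → A) :
    ∑ c, g c = ∑ j ∈ Finset.range p, g j := by
  refine Finset.sum_nbij' (fun c => c.val) (fun j => (j : ZMod p)) ?_ ?_ ?_ ?_ ?_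
  · intro c _; simpa using ZMod.val_lt c
  · simp
  · simp
  · intro j hj; exact ZMod.val_cast_of_lt (by simpa using hj)
  · simp

theorem pow_dvd_sum_of_diffDvd {p : ℕ} [Fact p.Prime] (hπ : π ^ (p - 1) ∣ (p : R)) (hW : 0 < W)
    (D : ℕ) {b : ℕ} {F : (Fin D → ZMod p) → R} (hF : ∀ M, DiffDvd π W M b F) {E : ℕ}
    (hE : W * E < b + D * (p - 1) + W) : π ^ E ∣ ∑ x, F x := by
  induction D generalizing b with
  | zero =>
    rw [Fintype.sum_unique]
    exact (hF 0).pow_dvd (by simpa using hE) _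
  | succ D ih =>
    let ι : (Fin D → ZMod p) →+ (Fin (D + 1) → ZMod p) :=
      { toFun := fun x => Fin.cons 0 x
        map_zero' := by ext i; cases i using Fin.cases <;> simp
        map_add' := fun x y => by ext i; cases i using Fin.cases <;> simp }
    let v : Fin (D + 1) → ZMod p := Fin.cons 1 0
    -- Sum along the first coordinate: this raises b by p - 1 but uses up orders of differences,
    -- hence the hypothesis for all M.
    have hsum : ∑ x, F x = ∑ x, ∑ j ∈ Finset.range p, F (ι x + j • v) := by
      rw [← (Fin.consEquiv fun _ : Fin (D + 1) => ZMod p).sum_comp, Fintype.sum_prod_type,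
        Finset.sum_comm]
      refine Finset.sum_congr rfl fun x _ => ?_
      rw [sum_zmod_eq_sum_range]
      refine Finset.sum_congr rfl fun j _ => congrArg F ?_
      ext i
      cases i using Fin.cases <;> simp [ι, v, Fin.consEquiv]
    rw [hsum]
    refine ih (b := b + (p - 1))
      (fun M => (DiffDvd.sum_line Fact.out hπ hW hF v M).comap ι) ?_
    rw [add_mul, one_mul] at hE
    omega

/-- Ax's divisibility theorem for character sums of functions of bounded functional degree. -/
theorem pow_dvd_sum_addChar {p : ℕ} [Fact p.Prime] (hπ : π ^ (p - 1) ∣ (p : R)) (hW : 0 < W)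
    {V A : Type*} [AddCommGroup V] [Fintype V] [Module (ZMod p) V] [AddCommGroup A]
    (ψ : AddChar A R) (hψ : ∀ a, π ∣ ψ a - 1) {h : V → A} (hh : FunctionalDegreeLE W h) {E : ℕ}
    (hE : W * E < Module.finrank (ZMod p) V * (p - 1) + W) : π ^ E ∣ ∑ x, ψ (h x) := by
  let φ := (Module.finBasis (ZMod p) V).equivFun.symm
  rw [← φ.toEquiv.sum_comp]
  exact pow_dvd_sum_of_diffDvd hπ hW _ (b := 0)
    (fun M => diffDvd_addChar ψ hψ M hW (hh.comap φ.toLinearMap.toAddMonoidHom)) (by omega)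

end DiffDvd

/-! ### Counting solutions by orthogonality -/

section Counting

variable {p : ℕ} [Fact p.Prime] {R : Type*} [CommRing R] [IsDomain R]
  {V : Type*} [AddCommGroup V] [Module (ZMod p) V] [Fintype V]

open Classical in
theorem sum_addChar_dual (ψ : AddChar (ZMod p) R) (hψ : ∀ a, ψ a = 1 → a = 0)
    (γ : Module.Dual (ZMod p) V) :
    ∑ v, ψ (γ v) = if γ = 0 then (Fintype.card V : R) else 0 := by
  have h := AddChar.sum_eq_ite (ψ.compAddMonoidHom γ.toAddMonoidHom)
  have hiff : ψ.compAddMonoidHom γ.toAddMonoidHom = 0 ↔ γ = 0 := by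
    rw [AddChar.eq_zero_iff]
    constructor
    · intro h0
      ext v
      exact hψ _ (h0 v)
    · rintro rfl v
      simp
  simpa [hiff] using h

open Classical in
theorem sum_dual_addChar [Fintype (Module.Dual (ZMod p) V)] (ψ : AddChar (ZMod p) R)
    (hψ : ∀ a, ψ a = 1 → a = 0) (v : V) :
    ∑ β : Module.Dual (ZMod p) V, ψ (β v) = if v = 0 then (Fintype.card V : R) else 0 := by
  have h := sum_addChar_dual ψ hψ (Module.Dual.eval (ZMod p) V v)
  have hiff : Module.Dual.eval (ZMod p) V v = 0 ↔ v = 0 := Module.eval_apply_eq_zero_iff _ v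
  have hcard : Fintype.card (Module.Dual (ZMod p) V) = Fintype.card V := by
    rw [Module.card_eq_pow_finrank (K := ZMod p), Subspace.dual_finrank_eq,
      ← Module.card_eq_pow_finrank]
  simpa [hiff, hcard] using h

open Classical in
/-- The number of solutions of `g x = L y` with `L` linear, as a sum of character sums. -/
theorem card_eq_sum_addChar [CharZero R] [Fintype (Module.Dual (ZMod p) V)]
    {X : Type*} [Fintype X] (ψ : AddChar (ZMod p) R) (hψ : ∀ a, ψ a = 1 → a = 0) (g : X → V)
    (L : V →ₗ[ZMod p] V) :
    (Nat.card {z : X × V // g z.1 = L z.2} : R) =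
      ∑ β : Module.Dual (ZMod p) V with β ∘ₗ L = 0, ∑ x, ψ (β (g x)) := by
  have hV : (Fintype.card V : R) ≠ 0 := Nat.cast_ne_zero.2 Fintype.card_ne_zero
  -- Detecting the equation by functionals costs a factor |V|; the sum over y returns it.
  refine mul_left_cancel₀ hV ?_
  calc (Fintype.card V : R) * (Nat.card {z : X × V // g z.1 = L z.2} : R)
      = ∑ x, ∑ y, ∑ β : Module.Dual (ZMod p) V, ψ (β (g x - L y)) := by
        simp_rw [sum_dual_addChar ψ hψ, sub_eq_zero]
        rw [← Fintype.sum_prod_type' (f := fun x y => if g x = L y then (Fintype.card V : R) else 0),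
          ← Finset.sum_filter, Finset.sum_const, nsmul_eq_mul, mul_comm, Nat.card_eq_fintype_card,
          Fintype.card_subtype]
    _ = ∑ x, ∑ β : Module.Dual (ZMod p) V, ∑ y, ψ (β (g x)) * ψ ((-(β ∘ₗ L)) y) := by
        refine Finset.sum_congr rfl fun x _ => ?_
        rw [Finset.sum_comm]
        refine Finset.sum_congr rfl fun β _ => Finset.sum_congr rfl fun y _ => ?_
        rw [← AddChar.map_add_eq_mul]
        simp [sub_eq_add_neg]
    _ = ∑ β : Module.Dual (ZMod p) V, ∑ x, ψ (β (g x)) *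
          (if β ∘ₗ L = 0 then (Fintype.card V : R) else 0) := by
        rw [Finset.sum_comm]
        refine Finset.sum_congr rfl fun β _ => Finset.sum_congr rfl fun x _ => ?_
        rw [← Finset.mul_sum, sum_addChar_dual ψ hψ]
        simp only [neg_eq_zero]
    _ = _ := by
        rw [Finset.mul_sum, Finset.sum_filter]
        refine Finset.sum_congr rfl fun β _ => ?_
        rw [← Finset.sum_mul]
        split_ifs <;> simp [mul_comm]

end Counting

/-! ### From powers of π to powers of p -/

section Valuation

/-- If `p` is associated to `π ^ (p - 1)`, then divisibility of an integer by a power of `π`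
bounds its `p`-adic valuation. -/
theorem pow_dvd_of_pow_dvd_natCast {R : Type*} [CommRing R] [IsDomain R] [CharZero R] {p : ℕ}
    (hp : p.Prime) {π : R} (hπ : Prime π) (hassoc : Associated (π ^ (p - 1)) (p : R))
    {N W D s : ℕ} (hdvd : ∀ E, W * E < D * (p - 1) + W → π ^ E ∣ (N : R))
    (hs : W * s < D + W) : p ^ s ∣ N := by
  rcases eq_or_ne N 0 with rfl | hN
  · exact dvd_zero _
  have hp1 := hp.two_le
  obtain ⟨r, u, hu, rfl⟩ := Nat.exists_eq_pow_mul_and_not_dvd hN p hp.ne_one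
  have hπp : π ∣ (p : R) := (dvd_pow_self π (by omega)).trans hassoc.dvd
  have hπu : ¬ π ∣ (u : R) := by
    intro h
    have hco : IsCoprime (p : ℤ) (u : ℤ) :=
      Nat.isCoprime_iff_coprime.2 ((Nat.Prime.coprime_iff_not_dvd hp).2 hu)
    obtain ⟨a, b, hab⟩ := hco
    have hab' : (a : R) * p + b * u = 1 := by exact_mod_cast congrArg (Int.cast : ℤ → R) hab
    exact hπ.not_isUnit (isUnit_of_dvd_one (hab' ▸ dvd_add (hπp.mul_left _) (h.mul_left _)))
  refine Dvd.dvd.mul_right (pow_dvd_pow p ?_) u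
  by_contra hlt
  -- If r < s then W * r < D, which allows one more factor π than p ^ r contains.
  have hE : W * ((p - 1) * r + 1) < D * (p - 1) + W := by
    have h1 : W * (r + 1) ≤ W * s := Nat.mul_le_mul_left W (by omega)
    have h2 : W * r < D := by rw [mul_add] at h1; omega
    have h3 : W * r * (p - 1) < D * (p - 1) := Nat.mul_lt_mul_of_pos_right h2 (by omega)
    calc W * ((p - 1) * r + 1) = W * r * (p - 1) + W := by ring
      _ < _ := by omega
  have h := hdvd _ hE
  push_cast at h
  have h' : π ^ ((p - 1) * r + 1) ∣ π ^ ((p - 1) * r) * (u : R) := by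
    rw [pow_mul π (p - 1) r]
    exact h.trans (((hassoc.pow_pow (n := r)).symm.mul_right (u : R)).dvd)
  rw [pow_succ] at h'
  exact hπu ((mul_dvd_mul_iff_left (pow_ne_zero _ hπ.ne_zero)).1 h')

end Valuation

/-! ### The cyclotomic character and positivity of W -/

open NumberField in
/-- The ring of integers of the `p`-th cyclotomic field carries a uniformizer above `p` and an
additive character of `ZMod p` that is injective but trivial modulo the uniformizer. -/
theorem exists_cyclotomic_addChar (p : ℕ) [Fact p.Prime] :
    ∃ π : 𝓞 (CyclotomicField p ℚ), Prime π ∧ Associated (π ^ (p - 1)) (p : 𝓞 (CyclotomicField p ℚ)) ∧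
      ∃ ψ : AddChar (ZMod p) (𝓞 (CyclotomicField p ℚ)),
        (∀ a, ψ a = 1 → a = 0) ∧ ∀ a, π ∣ ψ a - 1 := by
  have : IsCyclotomicExtension {p} ℚ (CyclotomicField p ℚ) :=
    CyclotomicField.isCyclotomicExtension p ℚ
  have hζ := IsCyclotomicExtension.zeta_spec p ℚ (CyclotomicField p ℚ)
  have hint := hζ.toInteger_isPrimitiveRoot
  refine ⟨hζ.toInteger - 1, hζ.zeta_sub_one_prime',
    IsCyclotomicExtension.Rat.associated_zeta_sub_one_pow_prime p hζ,
    AddChar.zmodChar p hint.pow_eq_one, fun a ha => ?_, fun a => ?_⟩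
  · rw [AddChar.zmodChar_apply] at ha
    exact (ZMod.val_eq_zero a).1
      (Nat.eq_zero_of_dvd_of_lt (hint.dvd_of_pow_eq_one _ ha) (ZMod.val_lt a))
  · rw [AddChar.zmodChar_apply]
    exact sub_one_dvd_pow_sub_one _ _

theorem maxDigitSum_pos {p Q k d : ℕ} (hp : 1 < p) (hQ : 1 < Q) (hk : 0 < k) (hd : 1 ≤ d) :
    0 < maxDigitSum p Q k d := by
  let t : Fin k → ℕ := Pi.single ⟨0, hk⟩ 1
  have ht : ∀ i, t i < Q := fun i => by
    by_cases h : i = ⟨0, hk⟩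
    · subst h; simpa [t] using hQ
    · simp only [t, Pi.single_eq_of_ne h]; omega
  have hle : ∑ i, digitSum p (t i) ≤ maxDigitSum p Q k d :=
    Finset.le_sup (f := fun t : Fin k → ℕ => ∑ i, digitSum p (t i))
      (by simpa [Fintype.mem_piFinset, t] using ⟨ht, hd⟩)
  have h1 : digitSum p (t ⟨0, hk⟩) ≤ ∑ i, digitSum p (t i) :=
    Finset.single_le_sum (f := fun i => digitSum p (t i)) (fun _ _ => Nat.zero_le _)
      (Finset.mem_univ _)
  have h2 : digitSum p (t ⟨0, hk⟩) = 1 := by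
    simp [t, digitSum, Nat.digits_of_lt p 1 one_ne_zero hp]
  omega

end ArtinSchreierCount

theorem mainTheorem8 (p e q m k d : ℕ) (hp : p.Prime) (hq : q = p ^ e)
    (K : Type*) [Field K] [Finite K] (hK : Nat.card K = q ^ m)
    (f : MvPolynomial (Fin k) K) (hd : 1 ≤ d) (hf : f.totalDegree = d) :
    ((⌈((e * m * k : ℕ) : ℚ) / (ArtinSchreierCount.maxDigitSum p (q ^ m) k d : ℚ)⌉₊ : ℕ) : ℕ∞) ≤
      emultiplicity p (ArtinSchreierCount.solutionCount f q) := by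
  classical
  have : Fact p.Prime := ⟨hp⟩
  have := Fintype.ofFinite K
  have hcard : Nat.card K = p ^ (e * m) := by rw [hK, hq, pow_mul]
  have : CharP K p := by
    refine charP_of_card_eq_prime_pow (f := e * m) ?_
    rw [← Nat.card_eq_fintype_card, hcard]
  let _ : Algebra (ZMod p) K := ZMod.algebra K p
  have : Finite (Module.Dual (ZMod p) K) := DFunLike.finite _
  have := Fintype.ofFinite (Module.Dual (ZMod p) K)
  have hk : 0 < k := by
    rcases Nat.eq_zero_or_pos k with rfl | hk
    · have h0 : f.totalDegree = 0 := by
        rw [MvPolynomial.eq_C_of_isEmpty f, MvPolynomial.totalDegree_C]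
      omega
    · exact hk
  have hrank : Module.finrank (ZMod p) (Fin k → K) = e * m * k := by
    have h1 : Module.finrank (ZMod p) K = e * m := by
      refine Nat.pow_right_injective hp.two_le ?_
      have := Module.card_eq_pow_finrank (K := ZMod p) (V := K)
      rw [ZMod.card, ← Nat.card_eq_fintype_card, hcard] at this
      exact this.symm
    rw [Module.finrank_pi_fintype]
    simp [h1, mul_comm]
  set W := ArtinSchreierCount.maxDigitSum p (q ^ m) k d with hWdef
  have hW : 0 < W :=
    ArtinSchreierCount.maxDigitSum_pos hp.one_lt (hK ▸ Finite.one_lt_card) hk hd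
  have hdeg : ArtinSchreierCount.FunctionalDegreeLE W
      (fun x : Fin k → K => MvPolynomial.eval x f) := by
    have := ArtinSchreierCount.functionalDegreeLE_eval p f
    rwa [hf, hK] at this
  obtain ⟨π, hπ, hassoc, ψ, hψ, hψπ⟩ := ArtinSchreierCount.exists_cyclotomic_addChar p
  -- As q is a power of p, y ^ q - y is additive, hence F_p-linear.
  let L : K →ₗ[ZMod p] K :=
    ((iterateFrobenius K p e).toAddMonoidHom - AddMonoidHom.id K).toZModLinearMap p
  have hL : ∀ y, L y = y ^ q - y := fun y => by
    simp [L, iterateFrobenius_def, hq]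
  have hcount := ArtinSchreierCount.card_eq_sum_addChar ψ hψ
    (fun x : Fin k → K => MvPolynomial.eval x f) L
  simp only [hL] at hcount
  refine le_emultiplicity_of_pow_dvd
    (ArtinSchreierCount.pow_dvd_of_pow_dvd_natCast hp hπ hassoc (W := W) (D := e * m * k)
      (fun E hE => ?_) ?_)
  · rw [ArtinSchreierCount.solutionCount, hcount]
    refine Finset.dvd_sum fun β _ => ?_
    exact ArtinSchreierCount.pow_dvd_sum_addChar hassoc.dvd hW ψ hψπ
      (hdeg.map β.toAddMonoidHom) (by rwa [hrank])
  · have hWQ : (0 : ℚ) < W := Nat.cast_pos.2 hW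
    have h := Nat.ceil_lt_add_one (a := ((e * m * k : ℕ) : ℚ) / (W : ℚ)) (by positivity)
    have h2 := mul_lt_mul_of_pos_left h hWQ
    rw [mul_add, mul_div_cancel₀ _ hWQ.ne', mul_one] at h2
    exact_mod_cast h2
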